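/- For a semigroup $S$ let $S^1$ be $S$ if $S$ has an identity element, and $S$ with an identity element $1$ adjoined otherwise. For $x,y\in S$ and $z_1,z_2,\ldots\in S^1$ put $\lambda_0=x$, $\rho_0=y$, $\lambda_{k+1}=\lambda_k z_{k+1}\rho_k$ and $\rho_{k+1}=\rho_k z_{k+1}\lambda_k$, and write $\lambda_k=\lambda_k(x,y,z_1,\ldots,z_k)$, $\rho_k=\rho_k(x,y,z_1,\ldots,z_k)$. Let $\eta_1$ be the equality relation on $S$, and for $k>1$ let $x\,\eta_k\,y$ if and only if there are $z_1,\ldots,z_k\in S^1$ with $x=\lambda_k(x,y,z_1,\ldots,z_k)$ and $y=\rho_k(x,y,z_1,\ldots,z_k)$. Let $\eta$ be the transitive closure of $\bigcup_{k\ge 1}\eta_k$, and let $\eta^*$ be the smallest congruence on $S$ containing $\eta$. Let $G$ be a finite group, let $n,m\ge 1$ be integers, and let $P=(p_{ji})$ be an $m\times n$ matrix with entries in $G$. Let $M=\mathcal M(G,n,m;P)$ be the finite completely simple semigroup of all triples $(g;i,j)$ with $g\in G$, $1\le i\le n$, $1\le j\le m$, with the product $(g;i,j)(g';i',j')=(g\,p_{ji'}\,g';i,j')$.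 Let $G_{\eta^*}$ be the quotient of the group $G/\eta^*$ by the smallest congruence which identifies the classes of $$p_{x,c'}^{-1}p_{x,c}\ \text{ and }\ p_{r,c'}^{-1}p_{r,c}\qquad(1\le c,c'\le n,\ 1\le x,r\le m)$$ and the classes of $$p_{d,y}\,p_{d',y}^{-1}\ \text{ and }\ p_{d,s}\,p_{d',s}^{-1}\qquad(1\le d,d'\le m,\ 1\le y,s\le n).$$ Then $M/\eta^*\cong G_{\eta^*}$. -/

import Mathlib

/-- The pairs `(λ_k, ρ_k)` attached to elements `x, y` and a sequence of multipliers: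
`λ_0 = x`, `ρ_0 = y`, `λ_{k+1} = λ_k z_{k+1} ρ_k`, `ρ_{k+1} = ρ_k z_{k+1} λ_k`.
The multiplier `z_{k+1}` is the value `z k`, so the `n`-th pair uses only `z 0, …, z (n - 1)`. -/
def malcevPair {T : Type*} [Mul T] (x y : T) (z : ℕ → T) : ℕ → T × T
  | 0 => (x, y)
  | k + 1 =>
    ((malcevPair x y z k).1 * z k * (malcevPair x y z k).2,
     (malcevPair x y z k).2 * z k * (malcevPair x y z k).1)

/-- The word `λ_n(x, y, z_1, …, z_n)`. -/
def malcevLambda {T : Type*} [Mul T] (n : ℕ) (x y : T) (z : ℕ → T) : T :=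
  (malcevPair x y z n).1

/-- The word `ρ_n(x, y, z_1, …, z_n)`. -/
def malcevRho {T : Type*} [Mul T] (n : ℕ) (x y : T) (z : ℕ → T) : T :=
  (malcevPair x y z n).2

/-- The relation `η_n` on a semigroup `S`, for `n ≥ 1`: `η_1` is equality, and for `n > 1`,
`x η_n y` if `x = λ_n(x, y, z_1, …, z_n)` and `y = ρ_n(x, y, z_1, …, z_n)` for some
`z_1, …, z_n` in `S¹`. Here `S¹` is `WithOne S`; if `S` already has an identity element `e`,
the adjoined `1` acts on `S` exactly as `e` does, so the relation is the same as with `S¹ = S`. -/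
def etaLevel (S : Type*) [Semigroup S] (n : ℕ) (x y : S) : Prop :=
  (n = 1 ∧ x = y) ∨
  (1 < n ∧ ∃ z : ℕ → WithOne S,
    (x : WithOne S) = malcevLambda n (x : WithOne S) (y : WithOne S) z ∧
    (y : WithOne S) = malcevRho n (x : WithOne S) (y : WithOne S) z)

/-- The relation `η`: the transitive closure of the union of the `η_n`, `n ≥ 1`. -/
def etaRel (S : Type*) [Semigroup S] : S → S → Prop :=
  Relation.TransGen fun x y => ∃ n : ℕ, 1 ≤ n ∧ etaLevel S n x y

/-- The congruence `η*`: the smallest congruence on `S` containing `η`. -/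
def etaStar (S : Type*) [Semigroup S] : Con S :=
  conGen (etaRel S)

/-- The Rees matrix semigroup `M(G, n, m; P)` without zero, where `P` is an `m × n` matrix over
`G`: its elements are the triples `(g; i, j)` with `g ∈ G`, `i` among the `n` column indices of
`P` and `j` among the `m` row indices of `P`. -/
@[ext]
structure ReesMatrix {G : Type*} {n m : ℕ} (P : Matrix (Fin m) (Fin n) G) where
  g : G
  i : Fin n
  j : Fin m

/-- The product `(g; i, j)(g'; i', j') = (g p_{j i'} g'; i, j')`. -/
instance ReesMatrix.instSemigroup {G : Type*} [Group G] {n m : ℕ}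
    (P : Matrix (Fin m) (Fin n) G) : Semigroup (ReesMatrix P) where
  mul a b := ⟨a.g * P a.j b.i * b.g, a.i, b.j⟩
  mul_assoc a b c := by
    ext1
    · change a.g * P a.j b.i * b.g * P b.j c.i * c.g =
        a.g * P a.j b.i * (b.g * P b.j c.i * c.g)
      simp only [mul_assoc]
    · rfl
    · rfl

/-- The pairs of elements of `G/η*` that are to be identified: for all columns `c, c'` and all
rows `x, r`, the classes of `p_{x c'}⁻¹ p_{x c}` and `p_{r c'}⁻¹ p_{r c}`, and for all rows
`d, d'` and all columns `y, s`, the classes of `p_{d y} p_{d' y}⁻¹` and `p_{d s} p_{d' s}⁻¹`.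
As all entries of `P` are in `G`, all columns form one block, and so do all rows. -/
def sandwichRel {G : Type*} [Group G] {n m : ℕ} (P : Matrix (Fin m) (Fin n) G)
    (u v : (etaStar G).Quotient) : Prop :=
  (∃ (c c' : Fin n) (x r : Fin m),
    u = (((P x c')⁻¹ * P x c : G) : (etaStar G).Quotient) ∧
    v = (((P r c')⁻¹ * P r c : G) : (etaStar G).Quotient)) ∨
  (∃ (d d' : Fin m) (y s : Fin n),
    u = ((P d y * (P d' y)⁻¹ : G) : (etaStar G).Quotient) ∧
    v = ((P d s * (P d' s)⁻¹ : G) : (etaStar G).Quotient))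

/-- The group `G_{η*}`: the quotient of the group `G/η*` by the smallest congruence that makes
the identifications `sandwichRel P`. It is a group by the Mathlib instance `Con.group`. -/
abbrev GEtaStar {G : Type*} [Group G] {n m : ℕ} (P : Matrix (Fin m) (Fin n) G) : Type _ :=
  (conGen (sandwichRel P)).Quotient

/-! `toGEtaStar`, which moves an element to the component `(i₀, j₀)` and projects, is onto `G_{η*}`;
its kernel is `η*`.

Kernel inside `η*`: all idempotents of `M` are `η*`-related, so each element is related to its copy
in the maximal subgroup (`etaStar_ofGroup_toGroup`). The congruence induced there contains `η*(G)`
and, by `groupCon_entry`, makes the defining identifications of `G_{η*}`.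

`η*` inside the kernel: homomorphisms preserve `η_n`, so it suffices that every `η_n` on `G_{η*}` is
equality. As `G` is finite, an `η_n`-pair in its quotient lifts to an `η_k`-pair in `G` for some `k`
(`exists_etaLevel_lift`), and that pair is already collapsed. -/

theorem malcevPair_add {T : Type*} [Mul T] (x y : T) (z : ℕ → T) (a b : ℕ) :
    malcevPair x y z (a + b) =
      malcevPair (malcevPair x y z a).1 (malcevPair x y z a).2 (fun i => z (a + i)) b := by
  induction b with
  | zero => rfl
  | succ b ih => rw [← add_assoc]; simp only [malcevPair, ih]

theorem malcevPair_congr {T : Type*} [Mul T] (x y : T) {z w : ℕ → T} {n : ℕ}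
    (h : ∀ i < n, z i = w i) : malcevPair x y z n = malcevPair x y w n := by
  induction n with
  | zero => rfl
  | succ n ih =>
    simp only [malcevPair, ih fun i hi => h i (by omega), h n (by omega)]

theorem malcevPair_map {T U : Type*} [Mul T] [Mul U] (f : T →ₙ* U) (x y : T) (z : ℕ → T)
    (n : ℕ) : malcevPair (f x) (f y) (fun i => f (z i)) n =
      (f (malcevPair x y z n).1, f (malcevPair x y z n).2) := by
  induction n with
  | zero => rfl
  | succ n ih => simp only [malcevPair, ih, map_mul]

/-- Repeating the first `k` multipliers periodically iterates the map
`p ↦ (λ_k(p, z), ρ_k(p, z))`. -/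
theorem malcevPair_mul {T : Type*} [Mul T] (x y : T) (z : ℕ → T) (k t : ℕ) :
    malcevPair x y (fun i => z (i % k)) (k * t) =
      (fun p : T × T => malcevPair p.1 p.2 z k)^[t] (x, y) := by
  induction t with
  | zero => rfl
  | succ t ih =>
    rw [Function.iterate_succ_apply', mul_add, mul_one, malcevPair_add, ih]
    refine malcevPair_congr _ _ fun i hi => ?_
    rw [Nat.mul_add_mod, Nat.mod_eq_of_lt hi]

/-- Every such word begins and ends with a letter from `S`, so multipliers equal to `1` never take
it out of `S`. -/
theorem exists_coe_eq_malcevPair {S : Type*} [Semigroup S] (x y : S) (z : ℕ → WithOne S)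
    (n : ℕ) : ∃ x' y' : S, malcevPair (x : WithOne S) (y : WithOne S) z n =
      ((x' : WithOne S), (y' : WithOne S)) := by
  have key : ∀ (a b : S) (w : WithOne S), ∃ c : S, (a : WithOne S) * w * b = c := by
    intro a b w
    induction w using WithOne.recOneCoe with
    | one => exact ⟨a * b, by simp⟩
    | coe w => exact ⟨a * w * b, by simp⟩
  induction n with
  | zero => exact ⟨x, y, rfl⟩
  | succ n ih =>
    obtain ⟨a, b, h⟩ := ih
    obtain ⟨c, hc⟩ := key a b (z n)
    obtain ⟨d, hd⟩ := key b a (z n)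
    exact ⟨c, d, by simp only [malcevPair, h, hc, hd]⟩

/-! ### The relations `η_n` and `η*` under homomorphisms -/

theorem etaLevel_iff_of_one_lt {S : Type*} [Semigroup S] {n : ℕ} (hn : 1 < n) (x y : S) :
    etaLevel S n x y ↔ ∃ z : ℕ → WithOne S,
      malcevPair (x : WithOne S) (y : WithOne S) z n = ((x : WithOne S), (y : WithOne S)) := by
  simp only [etaLevel, hn.ne', false_and, false_or, hn, true_and, malcevLambda, malcevRho,
    Prod.ext_iff, eq_comm]

theorem etaLevel.map {S T : Type*} [Semigroup S] [Semigroup T] (f : S →ₙ* T) {n : ℕ} {x y : S}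
    (h : etaLevel S n x y) : etaLevel T n (f x) (f y) := by
  by_cases hn : 1 < n
  · rw [etaLevel_iff_of_one_lt hn] at h ⊢
    obtain ⟨z, hz⟩ := h
    refine ⟨fun i => WithOne.mapMulHom f (z i), ?_⟩
    have := malcevPair_map (WithOne.mapMulHom f : WithOne S →ₙ* WithOne T) x y z n
    simpa [hz] using this
  · rcases h with ⟨h1, h2⟩ | ⟨h1, -⟩
    · exact Or.inl ⟨h1, h2 ▸ rfl⟩
    · exact absurd h1 hn

/-- `η*` is contained in a congruence as soon as every `η_n` is. -/
theorem etaStar_le_iff {S : Type*} [Semigroup S] {c : Con S} :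
    etaStar S ≤ c ↔ ∀ n x y, 1 ≤ n → etaLevel S n x y → c x y := by
  rw [etaStar, Con.conGen_le]
  refine ⟨fun h n x y hn hxy => h _ _ (Relation.TransGen.single ⟨n, hn, hxy⟩), fun h x y hxy => ?_⟩
  induction hxy with
  | single h1 => obtain ⟨n, hn, h1⟩ := h1; exact h n _ _ hn h1
  | tail _ h1 ih => obtain ⟨n, hn, h1⟩ := h1; exact c.trans ih (h n _ _ hn h1)

theorem etaStar_of_etaLevel {S : Type*} [Semigroup S] {n : ℕ} {x y : S} (hn : 1 ≤ n)
    (h : etaLevel S n x y) : etaStar S x y :=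
  etaStar_le_iff.1 le_rfl n x y hn h

theorem etaStar_map {S T : Type*} [Semigroup S] [Semigroup T] (f : S →ₙ* T) {x y : S}
    (h : etaStar S x y) : etaStar T (f x) (f y) := by
  have : etaStar S ≤ (etaStar T).comap f (map_mul f) :=
    etaStar_le_iff.2 fun n x y hn hxy => etaStar_of_etaLevel hn (hxy.map f)
  exact this h

/-- For a finite semigroup, pairs related by some `η_n` in a homomorphic image lift to
pairs related by some `η_m`. -/
theorem exists_etaLevel_lift {S T : Type*} [Semigroup S] [Semigroup T] [Finite S] (f : S →ₙ* T)
    (hf : Function.Surjective f) {n : ℕ} {a b : T} (h : etaLevel T n a b) :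
    ∃ (m : ℕ) (x y : S), 1 ≤ m ∧ f x = a ∧ f y = b ∧ etaLevel S m x y := by
  by_cases hn : 1 < n
  swap
  · rcases h with ⟨-, rfl⟩ | ⟨h1, -⟩
    · obtain ⟨x, rfl⟩ := hf a
      exact ⟨1, x, x, le_rfl, rfl, rfl, Or.inl ⟨rfl, rfl⟩⟩
    · exact absurd h1 hn
  rw [etaLevel_iff_of_one_lt hn] at h
  obtain ⟨w, hw⟩ := h
  obtain ⟨x, rfl⟩ := hf a
  obtain ⟨y, rfl⟩ := hf b
  have hsurj : Function.Surjective (WithOne.mapMulHom f) := by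
    intro u
    induction u using WithOne.recOneCoe with
    | one => exact ⟨1, map_one _⟩
    | coe u => obtain ⟨s, rfl⟩ := hf u; exact ⟨s, by simp⟩
  choose z hz using fun i => hsurj (w i)
  set F : WithOne S × WithOne S → WithOne S × WithOne S :=
    fun p => malcevPair p.1 p.2 z n with hF
  -- `F` lifts a map fixing `(f x, f y)`, so its orbit stays in the fibre over that pair.
  have hiter : ∀ t, ∃ x' y' : S, F^[t] ((x : WithOne S), (y : WithOne S)) =
      ((x' : WithOne S), (y' : WithOne S)) ∧ f x' = f x ∧ f y' = f y := by
    intro t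
    induction t with
    | zero => exact ⟨x, y, rfl, rfl, rfl⟩
    | succ t ih =>
      obtain ⟨x₁, y₁, h₁, hx₁, hy₁⟩ := ih
      obtain ⟨x₂, y₂, h₂⟩ := exists_coe_eq_malcevPair x₁ y₁ z n
      have hm := malcevPair_map (WithOne.mapMulHom f : WithOne S →ₙ* WithOne T) x₁ y₁ z n
      simp only [MulHom.coe_coe, WithOne.mapMulHom_coe, hz, hx₁, hy₁, hw, h₂,
        Prod.mk.injEq, WithOne.coe_inj] at hm
      exact ⟨x₂, y₂, by rw [Function.iterate_succ_apply', h₁, ← h₂], hm.1.symm, hm.2.symm⟩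
  have hfin : Finite (WithOne S) := inferInstanceAs (Finite (Option S))
  -- By finiteness the orbit is eventually periodic; the lift is its point at time `s`, with
  -- multipliers repeated for `t - s` rounds.
  obtain ⟨s, t, hst, heq⟩ : ∃ s t, s < t ∧ F^[s] ((x : WithOne S), (y : WithOne S)) =
      F^[t] ((x : WithOne S), (y : WithOne S)) := by
    obtain ⟨s, t, hne, h⟩ := Finite.exists_ne_map_eq_of_infinite
      fun t => F^[t] ((x : WithOne S), (y : WithOne S))
    rcases hne.lt_or_gt with hlt | hlt
    · exact ⟨s, t, hlt, h⟩
    · exact ⟨t, s, hlt, h.symm⟩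
  obtain ⟨x', y', h', hx', hy'⟩ := hiter s
  have hlt : 1 < n * (t - s) := lt_of_lt_of_le hn (Nat.le_mul_of_pos_right n (by omega))
  refine ⟨n * (t - s), x', y', hlt.le, hx', hy', (etaLevel_iff_of_one_lt hlt _ _).2
    ⟨fun i => z (i % n), ?_⟩⟩
  rw [malcevPair_mul, ← hF, ← h', ← Function.iterate_add_apply, Nat.sub_add_cancel hst.le, heq]

/-- If a homomorphism onto `T` from a finite semigroup `S` kills `η*(S)`, then all relations
`η_n` on `T` are trivial. -/
theorem eq_of_etaLevel_of_surjective {S T : Type*} [Semigroup S] [Semigroup T] [Finite S]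
    (f : S →ₙ* T) (hf : Function.Surjective f) (hker : ∀ x y, etaStar S x y → f x = f y)
    {n : ℕ} {a b : T} (h : etaLevel T n a b) : a = b := by
  obtain ⟨m, x, y, hm, rfl, rfl, hxy⟩ := exists_etaLevel_lift f hf h
  exact hker x y (etaStar_of_etaLevel hm hxy)

/-- With all multipliers `1`, one round fixes the pair in the first case and swaps it in the second;
two rounds restore it in both. -/
theorem etaLevel_two_of_mul_eq {S : Type*} [Semigroup S] {e f : S}
    (h : (e * f = e ∧ f * e = f) ∨ (e * f = f ∧ f * e = e)) : etaLevel S 2 e f := by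
  refine (etaLevel_iff_of_one_lt one_lt_two e f).2 ⟨fun _ => 1, ?_⟩
  simp only [malcevPair, mul_one, ← WithOne.coe_mul]
  rcases h with ⟨h1, h2⟩ | ⟨h1, h2⟩ <;> simp [h1, h2]

/-! ### Rees matrix semigroups -/

namespace ReesMatrix

variable {G : Type*} [Group G] {n m : ℕ} (P : Matrix (Fin m) (Fin n) G)

theorem mul_def (a b : ReesMatrix P) :
    a * b = ⟨a.g * P a.j b.i * b.g, a.i, b.j⟩ := rfl

/-- The idempotent in the `(i, j)` component. -/
def idem (i : Fin n) (j : Fin m) : ReesMatrix P := ⟨(P j i)⁻¹, i, j⟩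

/-- Idempotents sharing `j` form a left zero band, those sharing `i` a right zero band; `(i', j)`
links the two. -/
theorem etaStar_idem (i i' : Fin n) (j j' : Fin m) :
    etaStar (ReesMatrix P) (idem P i j) (idem P i' j') := by
  refine (etaStar _).trans (y := idem P i' j) ?_ ?_ <;>
    refine etaStar_of_etaLevel one_le_two (etaLevel_two_of_mul_eq ?_)
  · left; simp [idem, mul_def]
  · right; simp [idem, mul_def]

/-- The idempotent may be exchanged for one with first index `a.i`, which fixes `a` from the left.
-/
theorem etaStar_idem_mul (i : Fin n) (j : Fin m) (a : ReesMatrix P) :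
    etaStar (ReesMatrix P) (idem P i j * a) a := by
  have h := (etaStar _).mul (etaStar_idem P i a.i j j) ((etaStar _).refl a)
  have h2 : idem P a.i j * a = a := by simp [idem, mul_def]
  rwa [h2] at h

theorem etaStar_mul_idem (i : Fin n) (j : Fin m) (a : ReesMatrix P) :
    etaStar (ReesMatrix P) (a * idem P i j) a := by
  have h := (etaStar _).mul ((etaStar _).refl a) (etaStar_idem P i i j a.j)
  have h2 : a * idem P i a.j = a := by simp [idem, mul_def]
  rwa [h2] at h

/-- The embedding of `G` onto the maximal subgroup in the `(i, j)` component. -/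
def ofGroup (i : Fin n) (j : Fin m) : G →ₙ* ReesMatrix P where
  toFun g := ⟨g * (P j i)⁻¹, i, j⟩
  map_mul' g h := by simp [mul_def, mul_assoc]

theorem ofGroup_apply (i : Fin n) (j : Fin m) (g : G) :
    ofGroup P i j g = ⟨g * (P j i)⁻¹, i, j⟩ := rfl

/-- The coordinate in `G` of an element moved to the `(i₀, j₀)` component. -/
def toGroup (i₀ : Fin n) (j₀ : Fin m) (a : ReesMatrix P) : G :=
  (P j₀ i₀)⁻¹ * P j₀ a.i * a.g * P a.j i₀

theorem etaStar_ofGroup_toGroup (i₀ : Fin n) (j₀ : Fin m) (a : ReesMatrix P) :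
    etaStar (ReesMatrix P) (ofGroup P i₀ j₀ (toGroup P i₀ j₀ a)) a := by
  have h : ofGroup P i₀ j₀ (toGroup P i₀ j₀ a) = idem P i₀ j₀ * a * idem P i₀ j₀ := by
    simp [ofGroup_apply, toGroup, idem, mul_def]
  rw [h]
  exact (etaStar _).trans (etaStar_mul_idem P _ _ _) (etaStar_idem_mul P _ _ _)

/-- The congruence on `G` induced by `η*` on the Rees matrix semigroup. -/
def groupCon (i₀ : Fin n) (j₀ : Fin m) : Con G :=
  (etaStar (ReesMatrix P)).comap (ofGroup P i₀ j₀) (map_mul _)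

theorem etaStar_le_groupCon (i₀ : Fin n) (j₀ : Fin m) : etaStar G ≤ groupCon P i₀ j₀ :=
  fun _ _ h => etaStar_map (ofGroup P i₀ j₀) h

/-- Modulo the induced congruence, the sandwich matrix is a product of a column and a row. -/
theorem groupCon_entry (i₀ : Fin n) (j₀ : Fin m) (i : Fin n) (j : Fin m) :
    (groupCon P i₀ j₀).mk' (P j i) =
      (groupCon P i₀ j₀).mk' (P j i₀) * ((groupCon P i₀ j₀).mk' (P j₀ i₀))⁻¹ *
        (groupCon P i₀ j₀).mk' (P j₀ i) := by
  -- An idempotent is related to `idem P i₀ j₀`, the identity of the maximal subgroup, so its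
  -- coordinate becomes trivial.
  have h : (groupCon P i₀ j₀).mk' (toGroup P i₀ j₀ (idem P i j)) =
      (groupCon P i₀ j₀).mk' 1 := by
    refine (Con.eq _).2 ((etaStar _).trans (etaStar_ofGroup_toGroup P i₀ j₀ _) ?_)
    have h1 : ofGroup P i₀ j₀ 1 = idem P i₀ j₀ := by simp [ofGroup_apply, idem]
    exact h1 ▸ etaStar_idem P _ _ _ _
  simp only [toGroup, idem, map_mul, map_inv, map_one] at h
  rw [mul_eq_one_iff_eq_inv, mul_inv_eq_iff_eq_mul] at h
  rw [mul_assoc, h, mul_inv_cancel_left]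

variable {P}

/-- The canonical homomorphism from `G_{η*}` to the quotient of `G` by the induced congruence. -/
def ofGEtaStar (i₀ : Fin n) (j₀ : Fin m) : GEtaStar P →* (groupCon P i₀ j₀).Quotient :=
  Con.lift _ (Con.lift (etaStar G) (Con.mk' (groupCon P i₀ j₀)) (by
      rw [Con.mk'_ker]; exact etaStar_le_groupCon P i₀ j₀)) (by
    rw [Con.conGen_le]
    rintro u v (⟨c, c', x, r, rfl, rfl⟩ | ⟨d, d', y, s, rfl, rfl⟩) <;>
      rw [Con.ker_rel, Con.lift_coe, Con.lift_coe]
    · simp only [map_mul, map_inv]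
      rw [groupCon_entry P i₀ j₀ c x, groupCon_entry P i₀ j₀ c' x,
        groupCon_entry P i₀ j₀ c r, groupCon_entry P i₀ j₀ c' r]
      group
    · simp only [map_mul, map_inv]
      rw [groupCon_entry P i₀ j₀ y d, groupCon_entry P i₀ j₀ y d',
        groupCon_entry P i₀ j₀ s d, groupCon_entry P i₀ j₀ s d']
      group)

/-- The canonical projection of `G` onto `G_{η*}`. -/
def mkGEtaStar (P : Matrix (Fin m) (Fin n) G) : G →* GEtaStar P :=
  (Con.mk' (conGen (sandwichRel P))).comp (Con.mk' (etaStar G))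

theorem mkGEtaStar_surjective : Function.Surjective (mkGEtaStar P) :=
  Con.mk'_surjective.comp Con.mk'_surjective

theorem mkGEtaStar_eq_of_etaStar {g h : G} (hgh : etaStar G g h) :
    mkGEtaStar P g = mkGEtaStar P h :=
  congrArg (Con.mk' (conGen (sandwichRel P))) ((Con.eq _).2 hgh)

theorem groupCon_of_mkGEtaStar_eq (i₀ : Fin n) (j₀ : Fin m) {g h : G}
    (hgh : mkGEtaStar P g = mkGEtaStar P h) : groupCon P i₀ j₀ g h :=
  (Con.eq _).1 (congrArg (ofGEtaStar i₀ j₀) hgh)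

/-- This factorization makes `toGEtaStar` multiplicative; the first family of identifications
suffices for it. -/
theorem mkGEtaStar_entry (i₀ : Fin n) (j₀ : Fin m) (i : Fin n) (j : Fin m) :
    mkGEtaStar P (P j i) =
      mkGEtaStar P (P j i₀) * mkGEtaStar P ((P j₀ i₀)⁻¹ * P j₀ i) := by
  have h : mkGEtaStar P ((P j i₀)⁻¹ * P j i) = mkGEtaStar P ((P j₀ i₀)⁻¹ * P j₀ i) :=
    (Con.eq _).2 (ConGen.Rel.of _ _ (Or.inl ⟨i, i₀, j, j₀, rfl, rfl⟩))
  rw [← h, ← map_mul, mul_inv_cancel_left]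

/-- The homomorphism from the Rees matrix semigroup onto `G_{η*}`. -/
def toGEtaStar (P : Matrix (Fin m) (Fin n) G) (i₀ : Fin n) (j₀ : Fin m) :
    ReesMatrix P →ₙ* GEtaStar P where
  toFun a := mkGEtaStar P (toGroup P i₀ j₀ a)
  map_mul' a b := by
    simp only [toGroup, mul_def, map_mul, mkGEtaStar_entry i₀ j₀ b.i a.j, mul_assoc]

theorem toGEtaStar_surjective (i₀ : Fin n) (j₀ : Fin m) :
    Function.Surjective (toGEtaStar P i₀ j₀) := fun q => by
  obtain ⟨g, rfl⟩ := mkGEtaStar_surjective q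
  exact ⟨ofGroup P i₀ j₀ g, congrArg (mkGEtaStar P) (by simp [toGroup, ofGroup_apply])⟩

theorem toGEtaStar_eq_iff [Finite G] (i₀ : Fin n) (j₀ : Fin m) (a b : ReesMatrix P) :
    toGEtaStar P i₀ j₀ a = toGEtaStar P i₀ j₀ b ↔ etaStar (ReesMatrix P) a b := by
  constructor
  · intro h
    exact (etaStar _).trans ((etaStar _).symm (etaStar_ofGroup_toGroup P i₀ j₀ a))
      ((etaStar _).trans (groupCon_of_mkGEtaStar_eq i₀ j₀ h) (etaStar_ofGroup_toGroup P i₀ j₀ b))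
  · intro h
    have hle : etaStar (ReesMatrix P) ≤ Con.ker (toGEtaStar P i₀ j₀) :=
      etaStar_le_iff.2 fun k x y _ hxy =>
        eq_of_etaLevel_of_surjective (mkGEtaStar P : G →ₙ* GEtaStar P) mkGEtaStar_surjective
          (fun _ _ => mkGEtaStar_eq_of_etaStar) (hxy.map (toGEtaStar P i₀ j₀))
    exact hle h

end ReesMatrix

theorem mainTheorem7 {G : Type*} [Group G] [Finite G] {n m : ℕ} (hn : 0 < n) (hm : 0 < m)
    (P : Matrix (Fin m) (Fin n) G) :
    Nonempty ((etaStar (ReesMatrix P)).Quotient ≃* GEtaStar P) := by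
  let i₀ : Fin n := ⟨0, hn⟩
  let j₀ : Fin m := ⟨0, hm⟩
  let φ : (etaStar (ReesMatrix P)).Quotient →ₙ* GEtaStar P :=
    { toFun := fun q => Con.liftOn q (ReesMatrix.toGEtaStar P i₀ j₀)
        fun a b h => (ReesMatrix.toGEtaStar_eq_iff i₀ j₀ a b).2 h
      map_mul' := fun p q => Con.induction_on₂ p q fun a b => map_mul _ a b }
  have hinj : Function.Injective φ := fun p q =>
    Con.induction_on₂ p q fun a b h =>
      (Con.eq _).2 ((ReesMatrix.toGEtaStar_eq_iff i₀ j₀ a b).1 h)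
  have hsurj : Function.Surjective φ := fun q => by
    obtain ⟨a, rfl⟩ := ReesMatrix.toGEtaStar_surjective i₀ j₀ q
    exact ⟨(a : (etaStar (ReesMatrix P)).Quotient), rfl⟩
  exact ⟨MulEquiv.ofBijective φ ⟨hinj, hsurj⟩⟩
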